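/- Let $\mathbb{D}=\{z\in\mathbb{C}:|z|<1\}$. For $f$ analytic on $\mathbb{D}$ and $0\le r<1$ put $M_p(r,f)=\left(\int_0^{2\pi}|f(re^{i\theta})|^p\,\frac{d\theta}{2\pi}\right)^{1/p}$ if $0<p<\infty$ and $M_\infty(r,f)=\max_{0\le\theta<2\pi}|f(re^{i\theta})|$. For $0<p,q\le\infty$ and $0<\alpha<\infty$ put $$\|f\|_{p,q,\alpha}=\left(\alpha q\int_0^1(1-r)^{\alpha q-1}M_p(r,f)^q\,dr\right)^{1/q}\ \text{ if } q<\infty,\qquad \|f\|_{p,\infty,\alpha}=\sup_{0\le r<1}(1-r)^\alpha M_p(r,f),$$ and let $H(p,q,\alpha)$ be the space of all analytic $f$ on $\mathbb{D}$ with $\|f\|_{p,q,\alpha}<\infty$. Theorem. Let $0<\alpha,\beta<\infty$ and $0<p,q,u,v\le\infty$ with $p\ge u$. Then $$H(p,q,\alpha)\subseteq H(u,v,\beta)\iff \alpha<\beta,\ \text{ or }\ \alpha=\beta\text{ and }q\le v.$$ Moreover, when the inclusion holds, the inclusion operator is bounded, and for every $f\in H(p,q,\alpha)$: - if $\alpha<\beta$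 and $v<\infty$, then $\|f\|_{u,v,\beta}\le\left(\frac{\beta}{\beta-\alpha}\right)^{1/v}\|f\|_{p,q,\alpha}$; - if $\alpha=\beta$ and $q\le v<\infty$, then $\|f\|_{u,v,\beta}\le\left(\frac{v}{q}\right)^{1/v}\|f\|_{p,q,\alpha}$; - if $v=\infty$ (and $\alpha<\beta$, or $\alpha=\beta$), then $\|f\|_{u,\infty,\beta}\le\|f\|_{p,q,\alpha}$. -/

import Mathlib

open scoped ENNReal

/-- The integral mean `M_p(r, f)` of `f` over the circle of radius `r` about `0`, with respect to
normalized arc length; for `p = ∞` it is the supremum of `|f|` over that circle (a maximum when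
`f` is continuous there). The value is an extended nonnegative real. -/
noncomputable def integralMean (p : ℝ≥0∞) (r : ℝ) (f : ℂ → ℂ) : ℝ≥0∞ :=
  if p = ∞ then
    ⨆ θ ∈ Set.Ico (0 : ℝ) (2 * Real.pi), ‖f (r * Complex.exp (θ * Complex.I))‖ₑ
  else
    ((∫⁻ θ in Set.Ioo (0 : ℝ) (2 * Real.pi),
        ‖f (r * Complex.exp (θ * Complex.I))‖ₑ ^ p.toReal) /
      ENNReal.ofReal (2 * Real.pi)) ^ (1 / p.toReal)

/-- The mixed norm `‖f‖_{p,q,α}`, as an extended nonnegative real. -/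
noncomputable def mixedNorm (p q : ℝ≥0∞) (α : ℝ) (f : ℂ → ℂ) : ℝ≥0∞ :=
  if q = ∞ then
    ⨆ r ∈ Set.Ico (0 : ℝ) 1, ENNReal.ofReal ((1 - r) ^ α) * integralMean p r f
  else
    (ENNReal.ofReal (α * q.toReal) *
      ∫⁻ r in Set.Ioo (0 : ℝ) 1,
        ENNReal.ofReal ((1 - r) ^ (α * q.toReal - 1)) * integralMean p r f ^ q.toReal) ^
      (1 / q.toReal)

/-- The mixed norm space `H(p, q, α)`: functions analytic on the open unit disk with finite mixed
norm. Values of `f` outside the open unit disk play no role. -/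
def mixedNormSpace (p q : ℝ≥0∞) (α : ℝ) : Set (ℂ → ℂ) :=
  {f | AnalyticOnNhd ℂ f (Metric.ball 0 1) ∧ mixedNorm p q α f < ∞}

/-!
The inclusions rest on the growth estimate `mul_integralMean_le_mixedNorm`,
`(1 - r) ^ α * M_p(r, f) ≤ ‖f‖_{p,q,α}`. It follows from the monotonicity of the integral means in
the radius: restricting the integral defining the mixed norm to `(r, 1)` loses nothing in the
constant. Inserting it into `‖f‖_{p,v,β}` for all `v` factors `M_p` when `α < β`, and for `v - q` of
them when `α = β`, gives the stated constants; lowering the exponent of the mean from `p` to `u` only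
decreases the norm.

For `p = ∞` the monotonicity of the means is the maximum principle. For `p < ∞`, also below `1`,
Jensen's formula and the convexity of `exp` show that `‖f‖ ^ p` satisfies the sub-mean value
inequality on every closed disk where `f` is analytic (`norm_rpow_le_circleAverage`). Averaging over
rotations preserves this, so the mean over the circle of radius `‖z‖` is a radial subharmonic
function of `z`, and the maximum principle makes it monotone
(`monotoneOn_circleAverage_norm_rpow`).

For the necessity, let `v < q`, so that `v < ∞`, and consider the lacunary series with terms
`N ^ (j α) (j + 1) ^ (-1 / v) z ^ (N ^ j)`. If `N` is large, then on the circle of radius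
`1 - N ^ (-k) / 2` the `k`-th term dominates the sum of all the others pointwise. Hence
`M_u(r, f)` is comparable to `N ^ (k α) (k + 1) ^ (-1 / v)` near this circle for every `u`, and the
norms in `H(∞, q, α)` and `H(u, v, α)` are governed by `∑ (k + 1) ^ (-q / v) < ∞` and
`∑ (k + 1) ^ (-1) = ∞`. This settles `α = β`. If `β < α`, an intermediate weight `γ` would give
`H(p, ∞, γ) ⊆ H(p, q, α) ⊆ H(u, v, β) ⊆ H(u, 1, γ)`, which is excluded by the same example.
-/

/-! ### Monotonicity of the circle averages of `‖f‖ ^ p` -/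

open Metric Real in
/-- `‖f‖ ^ p` is subharmonic for every `p > 0`: by Jensen's formula `log ‖f‖` satisfies the
sub-mean value inequality, and `exp` is increasing and convex. -/
theorem norm_rpow_le_circleAverage {f : ℂ → ℂ} {c : ℂ} {R p : ℝ} (hp : 0 < p)
    (hf : AnalyticOnNhd ℂ f (closedBall c |R|)) :
    ‖f c‖ ^ p ≤ circleAverage (fun z ↦ ‖f z‖ ^ p) c R := by
  rcases eq_or_ne R 0 with rfl | hR
  · simp
  by_cases hc : f c = 0
  · rw [hc, norm_zero, zero_rpow hp.ne']
    exact circleAverage_nonneg_of_nonneg fun z _ ↦ by positivity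
  have hne : ∀ᶠ z in Filter.codiscreteWithin (sphere c |R|), f z ≠ 0 := by
    refine Filter.codiscreteWithin_mono sphere_subset_closedBall ?_
    rcases hf.eqOn_zero_or_eventually_ne_zero_of_preconnected
      (convex_closedBall c |R|).isPreconnected with h | h
    · exact absurd (h (mem_closedBall_self (abs_nonneg R))) hc
    · exact h
  have hlogint : CircleIntegrable (fun z ↦ log ‖f z‖) c R :=
    (hf.mono sphere_subset_closedBall).meromorphicOn.circleIntegrable_log_norm
  have hlog : log ‖f c‖ ≤ circleAverage (fun z ↦ log ‖f z‖) c R := by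
    rw [hf.circleAverage_log_norm hR hc]
    refine le_add_of_nonneg_left (finsum_nonneg fun u ↦ ?_)
    by_cases hu : u ∈ closedBall c |R|
    · rw [MeromorphicOn.AnalyticOnNhd.divisor_apply hf hu]
      refine mul_nonneg (by simp) ?_
      rcases eq_or_ne c u with rfl | hcu
      · simp
      rw [← log_abs]
      refine log_nonneg ?_
      have h0 : 0 < ‖c - u‖ := norm_pos_iff.2 (sub_ne_zero.2 hcu)
      rw [abs_mul, abs_inv, abs_norm, ← div_eq_mul_inv, one_le_div h0, ← dist_eq_norm, dist_comm]
      exact hu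
    · simp [hu]
  set A := ‖f c‖ ^ p with hA
  have hA0 : 0 ≤ A := by positivity
  have hint : CircleIntegrable (fun z ↦ ‖f z‖ ^ p) c R := by
    refine ContinuousOn.circleIntegrable' ?_
    exact ((hf.continuousOn.mono sphere_subset_closedBall).norm).rpow_const
      fun _ _ ↦ Or.inr hp.le
  -- The tangent line of `exp` at `p * log ‖f c‖`, evaluated at `p * log ‖f z‖`.
  let T : ℂ → ℝ := fun z ↦ A * (1 - p * log ‖f c‖) + (A * p) * log ‖f z‖
  have hTle : ∀ z, f z ≠ 0 → T z ≤ ‖f z‖ ^ p := by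
    intro z hz
    have h1 := add_one_le_exp (p * log ‖f z‖ - p * log ‖f c‖)
    have h2 : ‖f z‖ ^ p = A * exp (p * log ‖f z‖ - p * log ‖f c‖) := by
      rw [hA, rpow_def_of_pos (norm_pos_iff.2 hz), rpow_def_of_pos (norm_pos_iff.2 hc), ← exp_add]
      congr 1; ring
    rw [h2]
    calc T z = A * (p * log ‖f z‖ - p * log ‖f c‖ + 1) := by simp only [T]; ring
      _ ≤ _ := by gcongr
  have hTint : CircleIntegrable T c R :=
    (circleIntegrable_const _ c R).add (hlogint.const_smul (a := A * p))
  have hTavg : circleAverage T c R =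
      A * (1 - p * log ‖f c‖) + (A * p) * circleAverage (fun z ↦ log ‖f z‖) c R := by
    have := circleAverage_fun_add (circleIntegrable_const (A * (1 - p * log ‖f c‖)) c R)
      (hlogint.const_smul (a := A * p))
    simp only [Pi.smul_apply, smul_eq_mul] at this
    rw [show T = fun z ↦ A * (1 - p * log ‖f c‖) + (A * p) * log ‖f z‖ from rfl, this,
      circleAverage_const]
    congr 1
    exact circleAverage_smul
  calc A = A * (1 - p * log ‖f c‖) + (A * p) * log ‖f c‖ := by ring
    _ ≤ circleAverage T c R := by rw [hTavg]; gcongr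
    -- `T ≤ ‖f‖ ^ p` can fail at zeros of `f`, where `log 0 = 0`; they do not affect averages.
    _ = circleAverage (fun z ↦ min (T z) (‖f z‖ ^ p)) c R := by
        refine circleAverage_congr_codiscreteWithin ?_ hR
        filter_upwards [hne] with z hz using (min_eq_left (hTle z hz)).symm
    _ ≤ _ := by
        refine circleAverage_mono ?_ hint fun z _ ↦ min_le_right _ _
        refine hTint.congr_codiscreteWithin ?_
        filter_upwards [hne] with z hz using (min_eq_left (hTle z hz)).symm

open Real in
/-- Averaging `g (z * w)` over the unit circle `‖w‖ = 1` gives the mean of `g` over the circle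
through `z`. -/
theorem circleAverage_mul_left (g : ℂ → ℝ) (z : ℂ) :
    circleAverage (fun w ↦ g (z * w)) 0 1 = circleAverage g 0 ‖z‖ := by
  rw [circleAverage_eq_integral_add (f := g) z.arg, circleAverage]
  congr 2 with θ
  congr 1
  calc z * circleMap 0 1 θ = (‖z‖ * Complex.exp (z.arg * Complex.I)) * circleMap 0 1 θ := by
        rw [Complex.norm_mul_exp_arg_mul_I]
    _ = circleMap 0 ‖z‖ (θ + z.arg) := by
        simp only [circleMap, zero_add, Complex.ofReal_one, one_mul, Complex.ofReal_add, add_mul,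
          Complex.exp_add]
        ring

open Metric Real in
/-- The mean of `‖f‖ ^ p` over the circle through `z` centred at `0`, as a function of `z`,
satisfies the sub-mean value inequality: it is the average over `‖w‖ = 1` of the subharmonic
functions `‖f (z * w)‖ ^ p`. -/
theorem circleAverage_rpow_radial_le {f : ℂ → ℂ} {p : ℝ} (hp : 0 < p)
    (hf : AnalyticOnNhd ℂ f (ball 0 1)) {c : ℂ} {δ : ℝ} (hc : ‖c‖ + |δ| < 1) :
    circleAverage (fun z ↦ ‖f z‖ ^ p) 0 ‖c‖ ≤
      circleAverage (fun z ↦ circleAverage (fun w ↦ ‖f w‖ ^ p) 0 ‖z‖) c δ := by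
  have hmem : ∀ φ θ : ℝ, circleMap c δ φ * circleMap 0 1 θ ∈ ball (0 : ℂ) 1 := by
    intro φ θ
    rw [mem_ball_zero_iff, norm_mul, norm_circleMap_zero, abs_one, mul_one]
    have h : ‖circleMap c δ φ - c‖ = |δ| := by
      have := circleMap_mem_sphere' c δ φ
      rwa [mem_sphere_iff_norm] at this
    calc ‖circleMap c δ φ‖ = ‖c + (circleMap c δ φ - c)‖ := by ring_nf
      _ ≤ ‖c‖ + |δ| := by rw [← h]; exact norm_add_le _ _
      _ < 1 := hc
  have hcont : Continuous fun x : ℝ × ℝ ↦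
      ‖f (circleMap c δ x.1 * circleMap 0 1 x.2)‖ ^ p := by
    refine Continuous.rpow_const (Continuous.norm ?_) fun _ ↦ Or.inr hp.le
    refine hf.continuousOn.comp_continuous ?_ fun x ↦ hmem x.1 x.2
    exact ((continuous_circleMap c δ).comp continuous_fst).mul
      ((continuous_circleMap 0 1).comp continuous_snd)
  have hswap : circleAverage (fun z ↦ circleAverage (fun w ↦ ‖f w‖ ^ p) 0 ‖z‖) c δ =
      circleAverage (fun w ↦ circleAverage (fun z ↦ ‖f (z * w)‖ ^ p) c δ) 0 1 := by
    simp_rw [← circleAverage_mul_left (fun w ↦ ‖f w‖ ^ p)]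
    simp only [circleAverage, intervalIntegral.integral_smul]
    congr 2
    refine MeasureTheory.intervalIntegral_intervalIntegral_swap ?_
    exact (hcont.continuousOn.integrableOn_compact
      (isCompact_uIcc.prod isCompact_uIcc)).mono_set
        (Set.prod_mono Set.uIoc_subset_uIcc Set.uIoc_subset_uIcc)
  rw [hswap, ← circleAverage_mul_left (fun w ↦ ‖f w‖ ^ p)]
  refine circleAverage_mono ?_ ?_ ?_
  · refine Continuous.intervalIntegrable ?_ _ _
    refine Continuous.rpow_const (Continuous.norm ?_) fun _ ↦ Or.inr hp.le
    refine hf.continuousOn.comp_continuous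
      (continuous_const.mul (continuous_circleMap 0 1)) fun θ ↦ ?_
    rw [mem_ball_zero_iff, norm_mul, norm_circleMap_zero, abs_one, mul_one]
    linarith [abs_nonneg δ]
  · have h : Continuous fun θ : ℝ ↦
        ∫ φ in (0 : ℝ)..2 * π, ‖f (circleMap c δ φ * circleMap 0 1 θ)‖ ^ p := by
      refine intervalIntegral.continuous_parametric_intervalIntegral_of_continuous' ?_ _ _
      simpa only [Function.uncurry_def] using! hcont.comp continuous_swap
    exact (h.const_mul (2 * π)⁻¹).intervalIntegrable _ _
  intro w hw
  have hw1 : ‖w‖ = 1 := by simpa using hw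
  refine norm_rpow_le_circleAverage (f := fun z ↦ f (z * w)) hp fun z hz ↦ ?_
  have : AnalyticAt ℂ f (z * w) := by
    refine hf _ ?_
    rw [mem_ball_zero_iff, norm_mul, hw1, mul_one]
    rw [mem_closedBall_iff_norm] at hz
    calc ‖z‖ = ‖c + (z - c)‖ := by ring_nf
      _ ≤ ‖c‖ + ‖z - c‖ := norm_add_le _ _
      _ < 1 := by linarith
  exact AnalyticAt.fun_comp (f := fun z ↦ z * w) this (by fun_prop)

open Metric Real in
/-- **Hardy's convexity theorem**, monotonicity part. The means are the values on circles of a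
radial subharmonic function; at the largest point `s` of `[0, R]` where they attain their maximum,
the sub-mean value inequality on the circle of centre `s` through `R` forces `s = R`. -/
theorem monotoneOn_circleAverage_norm_rpow {f : ℂ → ℂ} {p : ℝ} (hp : 0 < p)
    (hf : AnalyticOnNhd ℂ f (ball 0 1)) :
    MonotoneOn (circleAverage (fun z ↦ ‖f z‖ ^ p) 0) (Set.Ico 0 1) := by
  intro r hr R hR hrR
  set g := circleAverage (fun z ↦ ‖f z‖ ^ p) 0 with hg
  have hgc : ContinuousOn g (Set.Ico 0 1) := by
    refine ContinuousOn.circleAverage ?_ fun r hr ↦ hr.1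
    refine ContinuousOn.rpow_const (ContinuousOn.norm ?_) fun _ _ ↦ Or.inr hp.le
    refine hf.continuousOn.mono fun z hz ↦ ?_
    simpa using hz.2
  have hsub : Set.Icc 0 R ⊆ Set.Ico 0 1 := fun x hx ↦ ⟨hx.1, hx.2.trans_lt hR.2⟩
  have hgR := hgc.mono hsub
  obtain ⟨m, hm, hmax⟩ := isCompact_Icc.exists_isMaxOn ⟨R, ⟨hR.1, le_rfl⟩⟩ hgR
  have hK : IsCompact (Set.Icc 0 R ∩ g ⁻¹' {g m}) :=
    isCompact_Icc.of_isClosed_subset (hgR.preimage_isClosed_of_isClosed isClosed_Icc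
      isClosed_singleton) Set.inter_subset_left
  obtain ⟨s, ⟨hsR, hsm⟩, hs⟩ := hK.exists_isMaxOn ⟨m, hm, rfl⟩ continuousOn_id
  have hsm : g s = g m := hsm
  rcases hsR.2.eq_or_lt with rfl | hlt
  · rw [hsm]; exact hmax ⟨hr.1, hrR⟩
  exfalso
  have hns : ‖(s : ℂ)‖ = s := by rw [Complex.norm_real, norm_eq_abs, abs_of_nonneg hsR.1]
  have hδ : |R - s| = R - s := abs_of_pos (sub_pos.2 hlt)
  have hsub := circleAverage_rpow_radial_le hp hf (c := (s : ℂ)) (δ := R - s) (by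
    rw [hns, hδ]; linarith [hR.2])
  rw [← hg, hns, hsm] at hsub
  have hmem : ∀ θ, ‖circleMap s (R - s) θ‖ ∈ Set.Icc 0 R := fun θ ↦ by
    refine ⟨norm_nonneg _, ?_⟩
    have h := circleMap_mem_sphere' (s : ℂ) (R - s) θ
    rw [mem_sphere_iff_norm, hδ] at h
    calc ‖circleMap s (R - s) θ‖ = ‖(s : ℂ) + (circleMap s (R - s) θ - s)‖ := by ring_nf
      _ ≤ ‖(s : ℂ)‖ + (R - s) := (norm_add_le _ _).trans_eq (by rw [h])
      _ = R := by rw [hns]; ring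
  have hltR : g R < g m := by
    refine lt_of_le_of_ne (hmax ⟨hR.1, le_rfl⟩) fun h ↦ ?_
    exact absurd (hs ⟨⟨hR.1, le_rfl⟩, h⟩) (not_le.2 hlt)
  have hcont : Continuous fun θ ↦ g ‖circleMap s (R - s) θ‖ :=
    hgR.comp_continuous (continuous_circleMap _ _).norm hmem
  have hlt2 : circleAverage (fun z ↦ g ‖z‖) s (R - s) <
      circleAverage (fun _ ↦ g m) (s : ℂ) (R - s) := by
    simp only [circleAverage, smul_eq_mul]
    refine mul_lt_mul_of_pos_left ?_ (by positivity)
    refine intervalIntegral.integral_lt_integral_of_continuousOn_of_le_of_exists_lt two_pi_pos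
      hcont.continuousOn continuousOn_const (fun θ _ ↦ hmax (hmem θ))
      ⟨0, ⟨le_rfl, two_pi_pos.le⟩, ?_⟩
    have : circleMap s (R - s) 0 = (R : ℂ) := by simp [circleMap]
    rw [this, Complex.norm_real, norm_eq_abs, abs_of_nonneg hR.1]
    exact hltR
  rw [circleAverage_const] at hlt2
  exact absurd hsub (not_le.2 hlt2)

/-! ### Integral means -/

theorem mul_exp_mem_ball {r : ℝ} (hr : r ∈ Set.Ico (0 : ℝ) 1) (θ : ℝ) :
    (r * Complex.exp (θ * Complex.I) : ℂ) ∈ Metric.ball (0 : ℂ) 1 := by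
  rw [mem_ball_zero_iff, norm_mul, Complex.norm_exp_ofReal_mul_I, mul_one, Complex.norm_real,
    Real.norm_eq_abs, abs_of_nonneg hr.1]
  exact hr.2

theorem continuous_comp_mul_exp {f : ℂ → ℂ} (hf : AnalyticOnNhd ℂ f (Metric.ball 0 1)) {r : ℝ}
    (hr : r ∈ Set.Ico (0 : ℝ) 1) :
    Continuous fun θ : ℝ ↦ f (r * Complex.exp (θ * Complex.I)) :=
  hf.continuousOn.comp_continuous (by fun_prop) (mul_exp_mem_ball hr)

open MeasureTheory Real in
theorem integralMean_eq_circleAverage {p : ℝ≥0∞} (hp : 0 < p) (hp' : p ≠ ∞) {f : ℂ → ℂ}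
    (hf : AnalyticOnNhd ℂ f (Metric.ball 0 1)) {r : ℝ} (hr : r ∈ Set.Ico (0 : ℝ) 1) :
    integralMean p r f =
      ENNReal.ofReal (circleAverage (fun z ↦ ‖f z‖ ^ p.toReal) 0 r) ^ (1 / p.toReal) := by
  have hp0 : 0 < p.toReal := ENNReal.toReal_pos hp.ne' hp'
  rw [integralMean, if_neg hp']
  congr 1
  have hc : Continuous fun θ : ℝ ↦ ‖f (r * Complex.exp (θ * Complex.I))‖ ^ p.toReal :=
    (continuous_comp_mul_exp hf hr).norm.rpow_const fun _ ↦ Or.inr hp0.le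
  simp only [circleAverage, circleMap, zero_add, smul_eq_mul]
  rw [ENNReal.ofReal_mul (p := (2 * π)⁻¹) (by positivity), ENNReal.ofReal_inv_of_pos two_pi_pos,
    ← ENNReal.div_eq_inv_mul, intervalIntegral.integral_of_le two_pi_pos.le,
    ofReal_integral_eq_lintegral_ofReal (hc.integrableOn_Ioc) (ae_of_all _ fun _ ↦ by positivity),
    restrict_Ioo_eq_restrict_Ioc]
  congr 2 with θ
  rw [← ENNReal.ofReal_rpow_of_nonneg (norm_nonneg _) hp0.le, ofReal_norm]

theorem enorm_le_integralMean_top {f : ℂ → ℂ} {r : ℝ} (hr : 0 ≤ r) {z : ℂ} (hz : ‖z‖ = r) :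
    ‖f z‖ₑ ≤ integralMean ∞ r f := by
  rw [integralMean, if_pos rfl]
  obtain ⟨θ, hθ, h⟩ : ∃ θ ∈ Set.Ico (0 : ℝ) (2 * Real.pi), circleMap 0 r θ = z := by
    have : z ∈ Set.range (circleMap 0 r) := by
      rw [range_circleMap]
      simp [hz, abs_of_nonneg hr]
    obtain ⟨φ, rfl⟩ := this
    obtain ⟨θ, hθ, h⟩ := (periodic_circleMap 0 r).exists_mem_Ico₀ Real.two_pi_pos φ
    exact ⟨θ, hθ, h.symm⟩
  refine le_iSup₂_of_le θ hθ ?_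
  rw [← h, circleMap, zero_add]

open Metric in
theorem integralMean_mono {p : ℝ≥0∞} (hp : 0 < p) {f : ℂ → ℂ}
    (hf : AnalyticOnNhd ℂ f (ball 0 1)) {r R : ℝ} (hr : 0 ≤ r) (hrR : r ≤ R) (hR : R < 1) :
    integralMean p r f ≤ integralMean p R f := by
  rcases eq_or_ne p ∞ with rfl | hp'
  · rcases hrR.eq_or_lt with rfl | hlt
    · rfl
    have hR0 : 0 < R := hr.trans_lt hlt
    obtain ⟨w, hw, hmax⟩ := Complex.exists_mem_frontier_isMaxOn_norm (f := f) isBounded_ball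
      (nonempty_ball.2 hR0) (U := ball 0 R) (by
        refine (hf.differentiableOn.mono ?_).diffContOnCl
        rw [closure_ball _ hR0.ne']
        exact closedBall_subset_ball hR)
    rw [frontier_ball _ hR0.ne', mem_sphere_zero_iff_norm] at hw
    refine le_trans ?_ (enorm_le_integralMean_top hR0.le hw)
    rw [integralMean, if_pos rfl]
    refine iSup₂_le fun θ _ ↦ ?_
    rw [enorm_le_iff_norm_le]
    refine hmax (subset_closure ?_)
    rwa [mem_ball_zero_iff, norm_mul, Complex.norm_exp_ofReal_mul_I, mul_one, Complex.norm_real,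
      Real.norm_eq_abs, abs_of_nonneg hr]
  · rw [integralMean_eq_circleAverage hp hp' hf ⟨hr, hrR.trans_lt hR⟩,
      integralMean_eq_circleAverage hp hp' hf ⟨hr.trans hrR, hR⟩]
    refine ENNReal.rpow_le_rpow (ENNReal.ofReal_le_ofReal ?_) (by positivity)
    exact monotoneOn_circleAverage_norm_rpow (ENNReal.toReal_pos hp.ne' hp') hf
      ⟨hr, hrR.trans_lt hR⟩ ⟨hr.trans hrR, hR⟩ hrR

open MeasureTheory Real in
/-- The integral means are `L ^ p` norms with respect to a probability measure. -/
theorem integralMean_mono_exponent {u p : ℝ≥0∞} (hu : 0 < u) (hup : u ≤ p) {f : ℂ → ℂ}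
    (hf : AnalyticOnNhd ℂ f (Metric.ball 0 1)) {r : ℝ} (hr : r ∈ Set.Ico (0 : ℝ) 1) :
    integralMean u r f ≤ integralMean p r f := by
  let μ : Measure ℝ := (ENNReal.ofReal (2 * π))⁻¹ • volume.restrict (Set.Ioo 0 (2 * π))
  have h2π : ENNReal.ofReal (2 * π) ≠ 0 := by simpa using pi_pos
  have : IsProbabilityMeasure μ := ⟨by
    rw [Measure.smul_apply, Measure.restrict_apply_univ, Real.volume_Ioo, sub_zero, smul_eq_mul,
      ENNReal.inv_mul_cancel h2π ENNReal.ofReal_ne_top]⟩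
  let F : ℝ → ℂ := fun θ ↦ f (r * Complex.exp (θ * Complex.I))
  have hF : AEStronglyMeasurable F μ := (continuous_comp_mul_exp hf hr).aestronglyMeasurable
  have heq : ∀ q : ℝ≥0∞, 0 < q → q ≠ ∞ → integralMean q r f = eLpNorm F q μ := by
    intro q hq hq'
    rw [integralMean, if_neg hq', eLpNorm_eq_lintegral_rpow_enorm_toReal hq.ne' hq',
      lintegral_smul_measure, smul_eq_mul, ← ENNReal.div_eq_inv_mul]
  have hle : eLpNorm F p μ ≤ integralMean p r f := by
    rcases eq_or_ne p ∞ with rfl | hp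
    · rw [eLpNorm_exponent_top]
      refine essSup_le_of_ae_le _ ?_
      refine ae_of_all _ fun θ ↦ enorm_le_integralMean_top hr.1 ?_
      rw [norm_mul, Complex.norm_exp_ofReal_mul_I, mul_one, Complex.norm_real,
        Real.norm_eq_abs, abs_of_nonneg hr.1]
    · exact (heq p (hu.trans_le hup) hp).ge
  rcases eq_or_ne u ∞ with rfl | hu'
  · rw [top_le_iff.1 hup]
  · rw [heq u hu hu']
    exact (eLpNorm_le_eLpNorm_of_exponent_le hup hF).trans hle

/-! ### Comparison of mixed norms -/

theorem mixedNorm_top {p : ℝ≥0∞} {α : ℝ} {f : ℂ → ℂ} : mixedNorm p ∞ α f =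
    ⨆ r ∈ Set.Ico (0 : ℝ) 1, ENNReal.ofReal ((1 - r) ^ α) * integralMean p r f := by
  rw [mixedNorm, if_pos rfl]

open MeasureTheory in
theorem mixedNorm_rpow {p q : ℝ≥0∞} (hq : 0 < q) (hq' : q ≠ ∞) {α : ℝ} {f : ℂ → ℂ} :
    mixedNorm p q α f ^ q.toReal = ENNReal.ofReal (α * q.toReal) *
      ∫⁻ r in Set.Ioo (0 : ℝ) 1,
        ENNReal.ofReal ((1 - r) ^ (α * q.toReal - 1)) * integralMean p r f ^ q.toReal := by
  rw [mixedNorm, if_neg hq', ← ENNReal.rpow_mul,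
    one_div_mul_cancel (ENNReal.toReal_pos hq.ne' hq').ne', ENNReal.rpow_one]

theorem mixedNorm_mono_exponent {u p q : ℝ≥0∞} (hu : 0 < u) (hup : u ≤ p) {α : ℝ} {f : ℂ → ℂ}
    (hf : AnalyticOnNhd ℂ f (Metric.ball 0 1)) : mixedNorm u q α f ≤ mixedNorm p q α f := by
  unfold mixedNorm
  split_ifs with hq
  · gcongr with r hr
    exact integralMean_mono_exponent hu hup hf hr
  · refine ENNReal.rpow_le_rpow (mul_le_mul_right
      (MeasureTheory.setLIntegral_mono' measurableSet_Ioo fun r hr ↦ ?_) _) (by positivity)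
    gcongr
    exact integralMean_mono_exponent hu hup hf ⟨hr.1.le, hr.2⟩

open MeasureTheory in
theorem lintegral_one_sub_rpow {a b c : ℝ} (hc : 0 < c) (hab : a ≤ b) (hb : b ≤ 1) :
    ∫⁻ r in Set.Ioo a b, ENNReal.ofReal ((1 - r) ^ (c - 1)) =
      ENNReal.ofReal (((1 - a) ^ c - (1 - b) ^ c) / c) := by
  have hint : IntervalIntegrable (fun r : ℝ ↦ (1 - r) ^ (c - 1)) volume a b := by
    have := (intervalIntegral.intervalIntegrable_rpow' (a := 1 - b) (b := 1 - a)
      (r := c - 1) (by linarith)).comp_sub_left 1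
    simpa using this.symm
  rw [restrict_Ioo_eq_restrict_Ioc, ← ofReal_integral_eq_lintegral_ofReal
    ((intervalIntegrable_iff_integrableOn_Ioc_of_le hab).1 hint),
    ← intervalIntegral.integral_of_le hab,
    intervalIntegral.integral_comp_sub_left (fun x ↦ x ^ (c - 1)),
    integral_rpow (by left; linarith),
    sub_add_cancel]
  filter_upwards [ae_restrict_mem measurableSet_Ioc] with r hr
  have := hr.2
  simp only [Pi.zero_apply]
  have : 0 ≤ 1 - r := by linarith
  positivity

open MeasureTheory in
/-- The growth estimate, with constant `1`. Since `M_p(s, f) ≥ M_p(r, f)` for `s ≥ r`, restricting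
the integral in the mixed norm to `(r, 1)` gives exactly the left-hand side. -/
theorem mul_integralMean_le_mixedNorm {p q : ℝ≥0∞} (hp : 0 < p) (hq : 0 < q) {α : ℝ} (hα : 0 < α)
    {f : ℂ → ℂ} (hf : AnalyticOnNhd ℂ f (Metric.ball 0 1)) {r : ℝ} (hr : r ∈ Set.Ico (0 : ℝ) 1) :
    ENNReal.ofReal ((1 - r) ^ α) * integralMean p r f ≤ mixedNorm p q α f := by
  rcases eq_or_ne q ∞ with rfl | hq'
  · rw [mixedNorm_top]
    exact le_iSup₂_of_le r hr le_rfl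
  have hq0 : 0 < q.toReal := ENNReal.toReal_pos hq.ne' hq'
  have hc : 0 < α * q.toReal := mul_pos hα hq0
  have h1r : 0 ≤ 1 - r := by linarith [hr.2]
  rw [← ENNReal.rpow_le_rpow_iff hq0, mixedNorm_rpow hq hq',
    ENNReal.mul_rpow_of_nonneg _ _ hq0.le, ENNReal.ofReal_rpow_of_nonneg (by positivity) hq0.le,
    ← Real.rpow_mul h1r]
  calc ENNReal.ofReal ((1 - r) ^ (α * q.toReal)) * integralMean p r f ^ q.toReal
      = ENNReal.ofReal (α * q.toReal) * ((∫⁻ s in Set.Ioo r 1,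
          ENNReal.ofReal ((1 - s) ^ (α * q.toReal - 1))) * integralMean p r f ^ q.toReal) := by
        rw [lintegral_one_sub_rpow hc hr.2.le le_rfl, ← mul_assoc, ← ENNReal.ofReal_mul hc.le,
          sub_self, Real.zero_rpow hc.ne', sub_zero, mul_div_cancel₀ _ hc.ne']
    _ ≤ ENNReal.ofReal (α * q.toReal) * ∫⁻ s in Set.Ioo r 1,
          ENNReal.ofReal ((1 - s) ^ (α * q.toReal - 1)) * integralMean p r f ^ q.toReal := by
        gcongr
        exact lintegral_mul_const_le _ _
    _ ≤ ENNReal.ofReal (α * q.toReal) * ∫⁻ s in Set.Ioo r 1,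
          ENNReal.ofReal ((1 - s) ^ (α * q.toReal - 1)) * integralMean p s f ^ q.toReal := by
        refine mul_le_mul_right (setLIntegral_mono' measurableSet_Ioo fun s hs ↦ ?_) _
        gcongr
        exact integralMean_mono hp hf hr.1 hs.1.le hs.2
    _ ≤ _ := by
        refine mul_le_mul_right (lintegral_mono_set ?_) _
        exact Set.Ioo_subset_Ioo_left hr.1

theorem mixedNorm_top_le {p q : ℝ≥0∞} (hp : 0 < p) (hq : 0 < q) {α β : ℝ} (hα : 0 < α)
    (hαβ : α ≤ β) {f : ℂ → ℂ} (hf : AnalyticOnNhd ℂ f (Metric.ball 0 1)) :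
    mixedNorm p ∞ β f ≤ mixedNorm p q α f := by
  rw [mixedNorm_top]
  refine iSup₂_le fun r hr ↦ le_trans ?_ (mul_integralMean_le_mixedNorm hp hq hα hf hr)
  refine mul_le_mul_left (ENNReal.ofReal_le_ofReal ?_) _
  exact Real.rpow_le_rpow_of_exponent_ge (by linarith [hr.2]) (by linarith [hr.1]) hαβ

open MeasureTheory in
theorem mixedNorm_le_of_lt {p q v : ℝ≥0∞} (hp : 0 < p) (hq : 0 < q) (hv : 0 < v) (hv' : v ≠ ∞)
    {α β : ℝ} (hα : 0 < α) (hαβ : α < β) {f : ℂ → ℂ}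
    (hf : AnalyticOnNhd ℂ f (Metric.ball 0 1)) :
    mixedNorm p v β f ≤
      ENNReal.ofReal ((β / (β - α)) ^ (1 / v.toReal)) * mixedNorm p q α f := by
  have hv0 : 0 < v.toReal := ENNReal.toReal_pos hv.ne' hv'
  have hβ : 0 < β := hα.trans hαβ
  have hβα : 0 < β - α := sub_pos.2 hαβ
  rw [← ENNReal.rpow_le_rpow_iff hv0, mixedNorm_rpow hv hv',
    ENNReal.mul_rpow_of_nonneg _ _ hv0.le, ENNReal.ofReal_rpow_of_nonneg (by positivity) hv0.le,
    ← Real.rpow_mul (by positivity), one_div_mul_cancel hv0.ne', Real.rpow_one]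
  have hc : 0 < (β - α) * v.toReal := by positivity
  calc _ ≤ ENNReal.ofReal (β * v.toReal) * ∫⁻ r in Set.Ioo (0 : ℝ) 1,
        ENNReal.ofReal ((1 - r) ^ ((β - α) * v.toReal - 1)) * mixedNorm p q α f ^ v.toReal := by
        refine mul_le_mul_right (setLIntegral_mono' measurableSet_Ioo fun r hr ↦ ?_) _
        have h1r : 0 < 1 - r := by linarith [hr.2]
        calc _ = ENNReal.ofReal ((1 - r) ^ ((β - α) * v.toReal - 1)) *
              (ENNReal.ofReal ((1 - r) ^ α) * integralMean p r f) ^ v.toReal := by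
              rw [ENNReal.mul_rpow_of_nonneg _ _ hv0.le, ENNReal.ofReal_rpow_of_pos (by positivity),
                ← mul_assoc, ← ENNReal.ofReal_mul (by positivity), ← Real.rpow_mul h1r.le,
                ← Real.rpow_add h1r]
              congr 4
              ring
          _ ≤ _ := by
              gcongr
              exact mul_integralMean_le_mixedNorm hp hq hα hf ⟨hr.1.le, hr.2⟩
    _ = _ := by
        rw [lintegral_mul_const _ (by fun_prop), lintegral_one_sub_rpow hc zero_le_one le_rfl,
          ← mul_assoc, ← ENNReal.ofReal_mul (by positivity)]
        congr 2
        simp only [sub_zero, Real.one_rpow, sub_self, Real.zero_rpow hc.ne']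
        field_simp

open MeasureTheory in
theorem mixedNorm_le_of_le {p q v : ℝ≥0∞} (hp : 0 < p) (hq : 0 < q) (hqv : q ≤ v) (hv' : v ≠ ∞)
    {α : ℝ} (hα : 0 < α) {f : ℂ → ℂ} (hf : AnalyticOnNhd ℂ f (Metric.ball 0 1))
    (hfin : mixedNorm p q α f ≠ ∞) :
    mixedNorm p v α f ≤
      ENNReal.ofReal ((v.toReal / q.toReal) ^ (1 / v.toReal)) * mixedNorm p q α f := by
  have hv : 0 < v := hq.trans_le hqv
  have hq' : q ≠ ∞ := ne_top_of_le_ne_top hv' hqv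
  have hv0 : 0 < v.toReal := ENNReal.toReal_pos hv.ne' hv'
  have hq0 : 0 < q.toReal := ENNReal.toReal_pos hq.ne' hq'
  have hle : 0 ≤ v.toReal - q.toReal := sub_nonneg.2 (ENNReal.toReal_mono hv' hqv)
  rw [← ENNReal.rpow_le_rpow_iff hv0, mixedNorm_rpow hv hv',
    ENNReal.mul_rpow_of_nonneg _ _ hv0.le, ENNReal.ofReal_rpow_of_nonneg (by positivity) hv0.le,
    ← Real.rpow_mul (by positivity), one_div_mul_cancel hv0.ne', Real.rpow_one]
  have hsplit : ∀ x : ℝ≥0∞, x ^ v.toReal = x ^ (v.toReal - q.toReal) * x ^ q.toReal := fun x ↦ by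
    rw [← ENNReal.rpow_add_of_nonneg _ _ hle hq0.le, sub_add_cancel]
  calc _ ≤ ENNReal.ofReal (α * v.toReal) * ∫⁻ r in Set.Ioo (0 : ℝ) 1,
        mixedNorm p q α f ^ (v.toReal - q.toReal) *
          (ENNReal.ofReal ((1 - r) ^ (α * q.toReal - 1)) * integralMean p r f ^ q.toReal) := by
        refine mul_le_mul_right (setLIntegral_mono' measurableSet_Ioo fun r hr ↦ ?_) _
        have h1r : 0 < 1 - r := by linarith [hr.2]
        calc _ = (ENNReal.ofReal ((1 - r) ^ α) * integralMean p r f) ^ (v.toReal - q.toReal) *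
              (ENNReal.ofReal ((1 - r) ^ (α * q.toReal - 1)) *
                integralMean p r f ^ q.toReal) := by
              rw [ENNReal.mul_rpow_of_nonneg _ _ hle, ENNReal.ofReal_rpow_of_pos (by positivity),
                hsplit (integralMean p r f), mul_mul_mul_comm, ← ENNReal.ofReal_mul (by positivity),
                ← Real.rpow_mul h1r.le, ← Real.rpow_add h1r]
              congr 4
              ring
          _ ≤ _ := by
              gcongr
              exact mul_integralMean_le_mixedNorm hp hq hα hf ⟨hr.1.le, hr.2⟩
    _ = _ := by
        rw [lintegral_const_mul' _ _ (ENNReal.rpow_ne_top_of_nonneg hle hfin),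
          hsplit (mixedNorm p q α f), mixedNorm_rpow hq hq',
          show α * v.toReal = (v.toReal / q.toReal) * (α * q.toReal) by field_simp,
          ENNReal.ofReal_mul (by positivity)]
        ring

/-! ### A lacunary series -/

open Real in
/-- A gap ratio `N` for which the terms of the lacunary series decay by a factor `1 / 16` away from
the dominant one: the first bound serves the terms of lower, the second those of higher degree. -/
theorem exists_lacunary_ratio {α : ℝ} (hα : 0 < α) (s : ℝ) :
    ∃ N : ℕ, 2 ≤ N ∧ 16 * 2 ^ s ≤ (N : ℝ) ^ α ∧ 16 * (N : ℝ) ^ α ≤ exp (N / 2) := by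
  have h1 : ∀ᶠ x : ℝ in Filter.atTop, 16 * 2 ^ s ≤ x ^ α :=
    (tendsto_rpow_atTop hα).eventually_ge_atTop _
  have h2 : ∀ᶠ x : ℝ in Filter.atTop, 16 * x ^ α ≤ exp (x / 2) := by
    have := (isLittleO_rpow_exp_pos_mul_atTop α (b := 1 / 2) (by norm_num)).bound
      (c := 1 / 16) (by norm_num)
    filter_upwards [this, Filter.eventually_ge_atTop 0] with x hx h0
    rw [norm_of_nonneg (by positivity), norm_of_nonneg (by positivity)] at hx
    rw [div_eq_inv_mul, ← one_div]
    linarith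
  obtain ⟨N, h⟩ := (tendsto_natCast_atTop_atTop.eventually (h1.and h2)).and
    (Filter.eventually_ge_atTop 2) |>.exists
  exact ⟨N, h.2, h.1.1, h.1.2⟩

/-- The coefficient `N ^ (j α) (j + 1) ^ (-s)` of `z ^ (N ^ j)` in the lacunary series. -/
noncomputable def lacunaryCoeff (N : ℕ) (α s : ℝ) (j : ℕ) : ℝ :=
  ((N : ℝ) ^ α) ^ j * ((j : ℝ) + 1) ^ (-s)

/-- The radius `1 - N ^ (-k) / 2`, at which the `k`-th term of the lacunary series dominates. -/
noncomputable def lacunaryRadius (N k : ℕ) : ℝ :=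
  1 - ((N : ℝ) ^ k)⁻¹ / 2

/-- The lacunary series `∑ j, N ^ (j α) (j + 1) ^ (-s) z ^ (N ^ j)`. -/
noncomputable def lacunarySeries (N : ℕ) (α s : ℝ) (z : ℂ) : ℂ :=
  ∑' j, (lacunaryCoeff N α s j : ℂ) * z ^ N ^ j

theorem lacunaryCoeff_pos {N : ℕ} (hN : 2 ≤ N) (α s : ℝ) (j : ℕ) : 0 < lacunaryCoeff N α s j := by
  have : (0 : ℝ) < N := by positivity
  unfold lacunaryCoeff
  positivity

theorem lacunaryRadius_mem {N : ℕ} (hN : 2 ≤ N) (k : ℕ) :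
    lacunaryRadius N k ∈ Set.Ico (1 / 2 : ℝ) 1 := by
  have h0 : (0 : ℝ) < N := by positivity
  have h1 : (1 : ℝ) ≤ (N : ℝ) ^ k := one_le_pow₀ (by exact_mod_cast (by omega : 1 ≤ N))
  have h2 := inv_le_one_of_one_le₀ h1
  have h3 : 0 < ((N : ℝ) ^ k)⁻¹ := by positivity
  constructor <;> unfold lacunaryRadius <;> linarith

theorem lacunaryRadius_mono {N : ℕ} (hN : 2 ≤ N) : Monotone (lacunaryRadius N) := by
  intro j k hjk
  have h0 : (0 : ℝ) < N := by positivity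
  have h1 : (1 : ℝ) ≤ N := by exact_mod_cast (by omega : 1 ≤ N)
  unfold lacunaryRadius
  gcongr

/-- At `r = 1 - N ^ (-k) / 2` the terms of the lacunary series decay geometrically on either side
of the `k`-th one: below `k` because the coefficients grow, above `k` because of the factor
`r ^ (N ^ j)`. -/
theorem lacunaryCoeff_mul_pow_le {N : ℕ} {α s : ℝ} (hs : 0 ≤ s) (hN : 2 ≤ N)
    (hN1 : 16 * 2 ^ s ≤ (N : ℝ) ^ α) (hN2 : 16 * (N : ℝ) ^ α ≤ Real.exp (N / 2)) (j k : ℕ) :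
    lacunaryCoeff N α s j * lacunaryRadius N k ^ N ^ j ≤
      lacunaryCoeff N α s k * (1 / 16) ^ ((j - k) + (k - j)) := by
  have h0 : (0 : ℝ) < N := by positivity
  have hr := lacunaryRadius_mem hN k
  have hr0 : 0 ≤ lacunaryRadius N k := by linarith [hr.1]
  rcases le_total j k with hjk | hkj
  · obtain ⟨i, rfl⟩ := Nat.exists_eq_add_of_le hjk
    have hexp : (j - (j + i)) + (j + i - j) = i := by omega
    rw [hexp]
    refine (mul_le_of_le_one_right (lacunaryCoeff_pos hN α s j).le
      (pow_le_one₀ hr0 hr.2.le)).trans ?_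
    have hi : ((i : ℝ) + 1) ^ s ≤ ((2 : ℝ) ^ s) ^ i := by
      rw [← Real.rpow_natCast, ← Real.rpow_mul (by norm_num), mul_comm,
        Real.rpow_mul (by norm_num)]
      refine Real.rpow_le_rpow (by positivity) ?_ hs
      rw [Real.rpow_natCast]
      exact_mod_cast Nat.lt_two_pow_self (n := i)
    have hji : ((j + i : ℕ) + 1 : ℝ) ^ s ≤ ((j : ℝ) + 1) ^ s * ((2 : ℝ) ^ s) ^ i := by
      refine le_trans ?_ (mul_le_mul_of_nonneg_left hi (by positivity))
      rw [← Real.mul_rpow (by positivity) (by positivity)]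
      refine Real.rpow_le_rpow (by positivity) ?_ hs
      push_cast
      nlinarith [mul_nonneg (Nat.cast_nonneg (α := ℝ) i) (Nat.cast_nonneg (α := ℝ) j)]
    have hA : ((2 : ℝ) ^ s) ^ i ≤ ((N : ℝ) ^ α) ^ i * (1 / 16) ^ i := by
      rw [← mul_pow]
      gcongr
      linarith
    unfold lacunaryCoeff
    rw [Real.rpow_neg (by positivity), Real.rpow_neg (by positivity), pow_add]
    have e1 : 0 < ((j : ℝ) + 1) ^ s := by positivity
    have e2 : 0 < ((j + i : ℕ) + 1 : ℝ) ^ s := by positivity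
    rw [← div_eq_mul_inv, div_le_iff₀ e1]
    calc ((N : ℝ) ^ α) ^ j = ((N : ℝ) ^ α) ^ j * (((j + i : ℕ) + 1 : ℝ) ^ s *
          (((j + i : ℕ) + 1 : ℝ) ^ s)⁻¹) := by rw [mul_inv_cancel₀ e2.ne', mul_one]
      _ ≤ ((N : ℝ) ^ α) ^ j * ((((j : ℝ) + 1) ^ s * (((N : ℝ) ^ α) ^ i * (1 / 16) ^ i)) *
          (((j + i : ℕ) + 1 : ℝ) ^ s)⁻¹) := by
          gcongr
          exact hji.trans (by gcongr)
      _ = _ := by ring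
  · obtain ⟨i, rfl⟩ := Nat.exists_eq_add_of_le hkj
    have hexp : (k + i - k) + (k - (k + i)) = i := by omega
    rw [hexp]
    have hNk : (0 : ℝ) < (N : ℝ) ^ k := by positivity
    have hrad : lacunaryRadius N k ^ N ^ (k + i) ≤ Real.exp (-((N : ℝ) ^ i / 2)) := by
      calc lacunaryRadius N k ^ N ^ (k + i) ≤ Real.exp (-(((N : ℝ) ^ k)⁻¹ / 2)) ^ N ^ (k + i) := by
            gcongr
            unfold lacunaryRadius
            linarith [Real.add_one_le_exp (-(((N : ℝ) ^ k)⁻¹ / 2))]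
        _ = _ := by
            rw [← Real.exp_nat_mul]
            congr 1
            push_cast
            rw [pow_add]
            field_simp
    have hi : (16 * (N : ℝ) ^ α) ^ i ≤ Real.exp ((N : ℝ) ^ i / 2) := by
      calc (16 * (N : ℝ) ^ α) ^ i ≤ Real.exp (N / 2) ^ i := by gcongr
        _ = Real.exp (i * (N / 2)) := by rw [← Real.exp_nat_mul]
        _ ≤ _ := by
            refine Real.exp_le_exp.2 ?_
            suffices (i : ℝ) * N ≤ (N : ℝ) ^ i by linarith
            rcases i with _ | i
            · simp
            · rw [pow_succ]
              gcongr
              exact_mod_cast (Nat.lt_pow_self (n := i) (a := N) (by omega))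
    have hprod : ((N : ℝ) ^ α) ^ i * lacunaryRadius N k ^ N ^ (k + i) ≤ (1 / 16) ^ i := by
      calc _ ≤ ((N : ℝ) ^ α) ^ i * Real.exp (-((N : ℝ) ^ i / 2)) := by gcongr
        _ = (16 * (N : ℝ) ^ α) ^ i * (1 / 16) ^ i * Real.exp (-((N : ℝ) ^ i / 2)) := by
            rw [← mul_pow]; congr 2; ring
        _ ≤ Real.exp ((N : ℝ) ^ i / 2) * (1 / 16) ^ i * Real.exp (-((N : ℝ) ^ i / 2)) := by
            gcongr
        _ = (1 / 16) ^ i := by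
            rw [mul_right_comm, ← Real.exp_add, add_neg_cancel, Real.exp_zero, one_mul]
    have hcoef : ((k + i : ℕ) + 1 : ℝ) ^ (-s) ≤ ((k : ℝ) + 1) ^ (-s) := by
      refine Real.rpow_le_rpow_of_nonpos (by positivity) ?_ (by linarith)
      push_cast
      linarith [Nat.cast_nonneg (α := ℝ) i]
    unfold lacunaryCoeff
    calc _ = ((N : ℝ) ^ α) ^ k * ((k + i : ℕ) + 1 : ℝ) ^ (-s) *
          (((N : ℝ) ^ α) ^ i * lacunaryRadius N k ^ N ^ (k + i)) := by rw [pow_add]; ring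
      _ ≤ _ := by gcongr

/-- The exponent is the distance `|j - k|`, written with truncated subtraction. -/
theorem summable_pow_dist_and_tsum_le (k : ℕ) :
    Summable (fun j : ℕ ↦ (1 / 16 : ℝ) ^ ((j - k) + (k - j))) ∧
      ∑' j : ℕ, (1 / 16 : ℝ) ^ ((j - k) + (k - j)) ≤ 17 / 15 := by
  have hshift : (fun i : ℕ ↦ (1 / 16 : ℝ) ^ ((i + k - k) + (k - (i + k)))) =
      fun i ↦ (1 / 16 : ℝ) ^ i := by
    ext i; congr 1; omega
  have hgeo : Summable fun i : ℕ ↦ (1 / 16 : ℝ) ^ i :=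
    summable_geometric_of_lt_one (by norm_num) (by norm_num)
  have hsum : Summable fun j : ℕ ↦ (1 / 16 : ℝ) ^ ((j - k) + (k - j)) := by
    rw [← summable_nat_add_iff k, hshift]
    exact hgeo
  refine ⟨hsum, ?_⟩
  rw [← hsum.sum_add_tsum_nat_add k, hshift, tsum_geometric_of_lt_one (by norm_num) (by norm_num)]
  have : ∑ j ∈ Finset.range k, (1 / 16 : ℝ) ^ ((j - k) + (k - j)) ≤ 1 / 15 := by
    calc _ = ∑ j ∈ Finset.range k, (1 / 16 : ℝ) ^ (k - 1 - j + 1) := by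
          refine Finset.sum_congr rfl fun j hj ↦ ?_
          congr 1
          have := Finset.mem_range.1 hj
          omega
      _ = ∑ j ∈ Finset.range k, (1 / 16 : ℝ) ^ (j + 1) :=
          Finset.sum_range_reflect (fun j ↦ (1 / 16 : ℝ) ^ (j + 1)) k
      _ ≤ ∑' j : ℕ, (1 / 16 : ℝ) ^ (j + 1) :=
          ((summable_nat_add_iff 1).2 hgeo).sum_le_tsum _ fun _ _ ↦ by positivity
      _ = 1 / 15 := by
          simp_rw [pow_succ]
          rw [tsum_mul_right, tsum_geometric_of_lt_one (by norm_num) (by norm_num)]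
          norm_num
  norm_num at this ⊢
  linarith

theorem norm_lacunary_term_le {N : ℕ} {α s : ℝ} (hs : 0 ≤ s) (hN : 2 ≤ N)
    (hN1 : 16 * 2 ^ s ≤ (N : ℝ) ^ α) (hN2 : 16 * (N : ℝ) ^ α ≤ Real.exp (N / 2))
    {k : ℕ} {z : ℂ} (hz : ‖z‖ ≤ lacunaryRadius N k) (j : ℕ) :
    ‖(lacunaryCoeff N α s j : ℂ) * z ^ N ^ j‖ ≤
      lacunaryCoeff N α s k * (1 / 16) ^ ((j - k) + (k - j)) := by
  refine le_trans ?_ (lacunaryCoeff_mul_pow_le hs hN hN1 hN2 j k)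
  have := (lacunaryCoeff_pos hN α s j).le
  rw [norm_mul, norm_pow, Complex.norm_real, Real.norm_of_nonneg this]
  gcongr

theorem analyticOnNhd_lacunarySeries {N : ℕ} {α s : ℝ} (hs : 0 ≤ s) (hN : 2 ≤ N)
    (hN1 : 16 * 2 ^ s ≤ (N : ℝ) ^ α) (hN2 : 16 * (N : ℝ) ^ α ≤ Real.exp (N / 2)) :
    AnalyticOnNhd ℂ (lacunarySeries N α s) (Metric.ball 0 1) := by
  refine DifferentiableOn.analyticOnNhd (fun z hz ↦ ?_) Metric.isOpen_ball
  rw [mem_ball_zero_iff] at hz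
  obtain ⟨k, hk⟩ : ∃ k, ‖z‖ < lacunaryRadius N k := by
    have hN' : (1 : ℝ) < N := by exact_mod_cast (by omega : 1 < N)
    obtain ⟨k, hk⟩ := exists_pow_lt_of_lt_one (sub_pos.2 hz) (inv_lt_one_of_one_lt₀ hN')
    refine ⟨k, ?_⟩
    have : 0 < ((N : ℝ)⁻¹) ^ k := by positivity
    rw [lacunaryRadius, ← inv_pow]
    linarith
  refine DifferentiableAt.differentiableWithinAt ?_
  have hd : DifferentiableOn ℂ (lacunarySeries N α s) (Metric.ball 0 (lacunaryRadius N k)) :=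
    Complex.differentiableOn_tsum_of_summable_norm
      ((summable_pow_dist_and_tsum_le k).1.mul_left (lacunaryCoeff N α s k))
      (fun j ↦ by fun_prop) Metric.isOpen_ball
      fun j w hw ↦ norm_lacunary_term_le hs hN hN1 hN2 (mem_ball_zero_iff.1 hw).le j
  exact hd.differentiableAt (Metric.isOpen_ball.mem_nhds (mem_ball_zero_iff.2 hk))

theorem norm_lacunarySeries_le {N : ℕ} {α s : ℝ} (hs : 0 ≤ s) (hN : 2 ≤ N)
    (hN1 : 16 * 2 ^ s ≤ (N : ℝ) ^ α) (hN2 : 16 * (N : ℝ) ^ α ≤ Real.exp (N / 2))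
    {k : ℕ} {z : ℂ} (hz : ‖z‖ ≤ lacunaryRadius N k) :
    ‖lacunarySeries N α s z‖ ≤ 2 * lacunaryCoeff N α s k := by
  obtain ⟨hsum, hle⟩ := summable_pow_dist_and_tsum_le k
  have hk := lacunaryCoeff_pos hN α s k
  refine (tsum_of_norm_bounded (hsum.mul_left (lacunaryCoeff N α s k)).hasSum
    (norm_lacunary_term_le hs hN hN1 hN2 hz)).trans ?_
  rw [tsum_mul_left]
  nlinarith

/-- On the circle of radius `1 - N ^ (-k) / 2` the `k`-th term has modulus at least half of its
coefficient, and all the others together at most `2 / 15` of it. -/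
theorem lacunaryCoeff_le_norm_lacunarySeries {N : ℕ} {α s : ℝ} (hs : 0 ≤ s) (hN : 2 ≤ N)
    (hN1 : 16 * 2 ^ s ≤ (N : ℝ) ^ α) (hN2 : 16 * (N : ℝ) ^ α ≤ Real.exp (N / 2))
    {k : ℕ} {z : ℂ} (hz : ‖z‖ = lacunaryRadius N k) :
    lacunaryCoeff N α s k / 4 ≤ ‖lacunarySeries N α s z‖ := by
  obtain ⟨hsum, hle⟩ := summable_pow_dist_and_tsum_le k
  have hk := lacunaryCoeff_pos hN α s k
  have h0 : (0 : ℝ) < N := by positivity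
  have hterm := norm_lacunary_term_le hs hN hN1 hN2 hz.le
  have hsum' := hsum.mul_left (lacunaryCoeff N α s k)
  have hS : Summable fun j ↦ (lacunaryCoeff N α s j : ℂ) * z ^ N ^ j :=
    Summable.of_norm_bounded hsum' hterm
  have hhalf : (1 / 2 : ℝ) ≤ lacunaryRadius N k ^ N ^ k := by
    have hNk : (0 : ℝ) < (N : ℝ) ^ k := by positivity
    have hb := one_add_mul_le_pow (a := -(((N : ℝ) ^ k)⁻¹ / 2)) (by
      have := lacunaryRadius_mem hN k
      unfold lacunaryRadius at this
      linarith [this.1]) (N ^ k)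
    have e : 1 + ((N ^ k : ℕ) : ℝ) * -(((N : ℝ) ^ k)⁻¹ / 2) = 1 / 2 := by
      push_cast; field_simp; norm_num
    rw [e] at hb
    exact hb.trans_eq (by rw [lacunaryRadius, sub_eq_add_neg])
  have hmain : lacunaryCoeff N α s k / 2 ≤ ‖(lacunaryCoeff N α s k : ℂ) * z ^ N ^ k‖ := by
    rw [norm_mul, norm_pow, hz, Complex.norm_real, Real.norm_of_nonneg hk.le]
    nlinarith
  have hrest : ‖∑' j, if j = k then 0 else (lacunaryCoeff N α s j : ℂ) * z ^ N ^ j‖ ≤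
      lacunaryCoeff N α s k * (2 / 15) := by
    have hsplit := hsum'.tsum_eq_add_tsum_ite k
    rw [tsum_mul_left] at hsplit
    have hsumi : Summable fun j ↦ if j = k then 0 else
        lacunaryCoeff N α s k * (1 / 16 : ℝ) ^ ((j - k) + (k - j)) := by
      refine Summable.of_nonneg_of_le (fun j ↦ ?_) (fun j ↦ ?_) hsum'
      · split_ifs <;> positivity
      · split_ifs
        · positivity
        · rfl
    refine (tsum_of_norm_bounded hsumi.hasSum fun j ↦ ?_).trans ?_
    · split_ifs
      · simp
      · exact hterm j
    · simp only [Nat.sub_self, add_zero, pow_zero, mul_one] at hsplit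
      nlinarith
  have heq : lacunarySeries N α s z = _ := hS.tsum_eq_add_tsum_ite k
  rw [heq]
  have := norm_sub_le_norm_add ((lacunaryCoeff N α s k : ℂ) * z ^ N ^ k)
    (∑' j, if j = k then 0 else (lacunaryCoeff N α s j : ℂ) * z ^ N ^ j)
  linarith

/-! ### Mixed norms of the lacunary series -/

theorem integralMean_lacunarySeries_le {N : ℕ} {α s : ℝ} (hs : 0 ≤ s) (hN : 2 ≤ N)
    (hN1 : 16 * 2 ^ s ≤ (N : ℝ) ^ α) (hN2 : 16 * (N : ℝ) ^ α ≤ Real.exp (N / 2))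
    {k : ℕ} {r : ℝ} (hr : 0 ≤ r) (hrk : r ≤ lacunaryRadius N k) :
    integralMean ∞ r (lacunarySeries N α s) ≤ ENNReal.ofReal (2 * lacunaryCoeff N α s k) := by
  rw [integralMean, if_pos rfl]
  refine iSup₂_le fun θ _ ↦ ?_
  rw [← ofReal_norm]
  refine ENNReal.ofReal_le_ofReal (norm_lacunarySeries_le hs hN hN1 hN2 ?_)
  rwa [norm_mul, Complex.norm_exp_ofReal_mul_I, mul_one, Complex.norm_real,
    Real.norm_of_nonneg hr]

open Real in
theorem ofReal_le_integralMean {p : ℝ≥0∞} (hp : 0 < p) {f : ℂ → ℂ}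
    (hf : AnalyticOnNhd ℂ f (Metric.ball 0 1)) {r m : ℝ} (hr : r ∈ Set.Ico (0 : ℝ) 1) (hm : 0 ≤ m)
    (h : ∀ z, ‖z‖ = r → m ≤ ‖f z‖) : ENNReal.ofReal m ≤ integralMean p r f := by
  rcases eq_or_ne p ∞ with rfl | hp'
  · have hz : ‖(r : ℂ)‖ = r := by rw [Complex.norm_real, norm_of_nonneg hr.1]
    refine le_trans ?_ (enorm_le_integralMean_top hr.1 hz)
    rw [← ofReal_norm]
    exact ENNReal.ofReal_le_ofReal (h _ hz)
  · have hp0 : 0 < p.toReal := ENNReal.toReal_pos hp.ne' hp'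
    rw [integralMean_eq_circleAverage hp hp' hf hr, one_div, ENNReal.le_rpow_inv_iff hp0,
      ENNReal.ofReal_rpow_of_nonneg hm hp0.le]
    refine ENNReal.ofReal_le_ofReal ?_
    rw [← circleAverage_const (m ^ p.toReal) 0 r]
    refine circleAverage_mono (circleIntegrable_const _ _ _) ?_ fun z hz ↦ ?_
    · refine ContinuousOn.circleIntegrable hr.1 ?_
      refine ContinuousOn.rpow_const (hf.continuousOn.mono ?_).norm fun _ _ ↦ Or.inr hp0.le
      intro z hz
      rw [mem_sphere_zero_iff_norm] at hz
      rw [mem_ball_zero_iff, hz]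
      exact hr.2
    · refine rpow_le_rpow hm (h z ?_) hp0.le
      rwa [mem_sphere_zero_iff_norm, abs_of_nonneg hr.1] at hz

theorem lacunaryCoeff_le_integralMean {N : ℕ} {α s : ℝ} (hs : 0 ≤ s) (hN : 2 ≤ N)
    (hN1 : 16 * 2 ^ s ≤ (N : ℝ) ^ α) (hN2 : 16 * (N : ℝ) ^ α ≤ Real.exp (N / 2))
    {u : ℝ≥0∞} (hu : 0 < u) {k : ℕ} {r : ℝ} (hrk : lacunaryRadius N k ≤ r) (hr : r < 1) :
    ENNReal.ofReal (lacunaryCoeff N α s k / 4) ≤ integralMean u r (lacunarySeries N α s) := by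
  have hf := analyticOnNhd_lacunarySeries hs hN hN1 hN2
  have hk := lacunaryRadius_mem hN k
  have hk0 : 0 ≤ lacunaryRadius N k := by linarith [hk.1]
  refine le_trans ?_ (integralMean_mono hu hf hk0 hrk hr)
  exact ofReal_le_integralMean hu hf ⟨hk0, hk.2⟩
    (by have := lacunaryCoeff_pos hN α s k; positivity)
    fun z hz ↦ lacunaryCoeff_le_norm_lacunarySeries hs hN hN1 hN2 hz

/-- The radii `1 - N ^ (-k) / 2` discretize `[0, 1)` with bounded ratio of distances to `1`. -/
theorem exists_le_lacunaryRadius {N : ℕ} (hN : 2 ≤ N) {r : ℝ} (hr : r ∈ Set.Ico (0 : ℝ) 1) :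
    ∃ k, r ≤ lacunaryRadius N k ∧ 1 - r < N * ((N : ℝ) ^ k)⁻¹ := by
  have h0 : (0 : ℝ) < N := by positivity
  have hN' : (1 : ℝ) < N := by exact_mod_cast (by omega : 1 < N)
  have hex : ∃ k, r ≤ lacunaryRadius N k := by
    obtain ⟨k, hk⟩ := exists_pow_lt_of_lt_one (sub_pos.2 hr.2) (inv_lt_one_of_one_lt₀ hN')
    refine ⟨k, ?_⟩
    have : 0 < ((N : ℝ)⁻¹) ^ k := by positivity
    rw [lacunaryRadius, ← inv_pow]
    linarith
  classical
  refine ⟨Nat.find hex, Nat.find_spec hex, ?_⟩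
  rcases hk : Nat.find hex with _ | k
  · simp only [pow_zero, inv_one, mul_one]
    linarith [hr.1]
  · have := Nat.find_min hex (m := k) (by omega)
    rw [not_le, lacunaryRadius] at this
    have hpos : 0 < ((N : ℝ) ^ k)⁻¹ := by positivity
    rw [pow_succ, mul_inv, mul_comm, mul_assoc, inv_mul_cancel₀ h0.ne', mul_one]
    linarith

theorem mixedNorm_top_lacunarySeries_lt_top {N : ℕ} {α s : ℝ} (hα : 0 < α) (hs : 0 ≤ s)
    (hN : 2 ≤ N) (hN1 : 16 * 2 ^ s ≤ (N : ℝ) ^ α) (hN2 : 16 * (N : ℝ) ^ α ≤ Real.exp (N / 2)) :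
    mixedNorm ∞ ∞ α (lacunarySeries N α s) < ∞ := by
  have h0 : (0 : ℝ) < N := by positivity
  rw [mixedNorm_top]
  refine lt_of_le_of_lt (iSup₂_le fun r hr ↦ ?_)
    (ENNReal.ofReal_lt_top (r := (N : ℝ) ^ α * 2))
  obtain ⟨k, hk, hk'⟩ := exists_le_lacunaryRadius hN hr
  have h1r : 0 ≤ 1 - r := by linarith [hr.2]
  refine (mul_le_mul_right (integralMean_lacunarySeries_le hs hN hN1 hN2 hr.1 hk) _).trans ?_
  rw [← ENNReal.ofReal_mul (by positivity)]
  refine ENNReal.ofReal_le_ofReal ?_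
  have hcoef : lacunaryCoeff N α s k ≤ ((N : ℝ) ^ α) ^ k := by
    refine mul_le_of_le_one_right (by positivity) ?_
    exact Real.rpow_le_one_of_one_le_of_nonpos (by linarith [Nat.cast_nonneg (α := ℝ) k])
      (by linarith)
  have hpow : (1 - r) ^ α ≤ (N : ℝ) ^ α * (((N : ℝ) ^ α) ^ k)⁻¹ := by
    refine (Real.rpow_le_rpow h1r hk'.le hα.le).trans_eq ?_
    rw [Real.mul_rpow h0.le (by positivity), Real.inv_rpow (by positivity),
      Real.rpow_pow_comm h0.le]
  have hpos : 0 < ((N : ℝ) ^ α) ^ k := by positivity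
  calc (1 - r) ^ α * (2 * lacunaryCoeff N α s k)
      ≤ (N : ℝ) ^ α * (((N : ℝ) ^ α) ^ k)⁻¹ * (2 * ((N : ℝ) ^ α) ^ k) := by
        gcongr
        have := lacunaryCoeff_pos hN α s k
        positivity
    _ = _ := by field_simp

theorem lacunaryCoeff_rpow {N : ℕ} (hN : 2 ≤ N) {α s : ℝ} (k : ℕ) (q : ℝ) :
    lacunaryCoeff N α s k ^ q = ((N : ℝ) ^ k) ^ (α * q) * ((k : ℝ) + 1) ^ (-(s * q)) := by
  have h0 : (0 : ℝ) < N := by positivity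
  rw [lacunaryCoeff, Real.mul_rpow (by positivity) (by positivity), Real.rpow_mul (by positivity),
    ← Real.rpow_mul (by positivity), ← Real.rpow_pow_comm h0.le, neg_mul]

open MeasureTheory in
theorem mixedNorm_lacunarySeries_lt_top {N : ℕ} {α s : ℝ} (hα : 0 < α) (hs : 0 ≤ s)
    (hN : 2 ≤ N) (hN1 : 16 * 2 ^ s ≤ (N : ℝ) ^ α) (hN2 : 16 * (N : ℝ) ^ α ≤ Real.exp (N / 2))
    {q : ℝ≥0∞} (hq' : q ≠ ∞) (hsq : 1 < s * q.toReal) :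
    mixedNorm ∞ q α (lacunarySeries N α s) < ∞ := by
  have h0 : (0 : ℝ) < N := by positivity
  have hq0 : 0 < q.toReal := by
    by_contra h
    have := mul_nonpos_of_nonneg_of_nonpos hs (not_lt.1 h)
    linarith
  have hc : 0 < α * q.toReal := mul_pos hα hq0
  -- The sets `J k` overlap, but they cover `(0, 1)`, which is enough for an upper bound.
  let J : ℕ → Set ℝ := fun k ↦
    {r | r ∈ Set.Ioo (1 - N * ((N : ℝ) ^ k)⁻¹) 1 ∧ 0 ≤ r ∧ r ≤ lacunaryRadius N k}
  have hJm : ∀ k, MeasurableSet (J k) := fun k ↦ by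
    simp only [J]
    exact measurableSet_Ioo.inter measurableSet_Icc
  let D : ℝ := (N : ℝ) ^ (α * q.toReal) / (α * q.toReal) * 2 ^ q.toReal
  have hJ : ∀ k, ∫⁻ r in J k, ENNReal.ofReal ((1 - r) ^ (α * q.toReal - 1)) *
      integralMean ∞ r (lacunarySeries N α s) ^ q.toReal ≤
        ENNReal.ofReal (D * ((k : ℝ) + 1) ^ (-(s * q.toReal))) := by
    intro k
    have hNk : 0 < (N : ℝ) ^ k := by positivity
    have hcoef := lacunaryCoeff_pos hN α s k
    calc _ ≤ ∫⁻ r in J k, ENNReal.ofReal ((1 - r) ^ (α * q.toReal - 1)) *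
          ENNReal.ofReal (2 * lacunaryCoeff N α s k) ^ q.toReal := by
          refine setLIntegral_mono' (hJm k) fun r hr ↦ ?_
          gcongr
          exact integralMean_lacunarySeries_le hs hN hN1 hN2 hr.2.1 hr.2.2
      _ ≤ ∫⁻ r in Set.Ioo (1 - N * ((N : ℝ) ^ k)⁻¹) 1,
          ENNReal.ofReal ((1 - r) ^ (α * q.toReal - 1)) *
          ENNReal.ofReal (2 * lacunaryCoeff N α s k) ^ q.toReal :=
          lintegral_mono_set fun r hr ↦ hr.1
      _ = _ := by
          rw [lintegral_mul_const _ (by fun_prop),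
            lintegral_one_sub_rpow hc (by simpa using by positivity) le_rfl, sub_sub_cancel,
            sub_self, Real.zero_rpow hc.ne', sub_zero,
            ENNReal.ofReal_rpow_of_nonneg (by positivity) hq0.le,
            ← ENNReal.ofReal_mul (by positivity),
            Real.mul_rpow (by norm_num) hcoef.le, lacunaryCoeff_rpow hN,
            Real.mul_rpow h0.le (by positivity), Real.inv_rpow hNk.le]
          congr 1
          have : 0 < ((N : ℝ) ^ k) ^ (α * q.toReal) := by positivity
          simp only [D]
          field_simp
  have hsum : Summable fun k : ℕ ↦ D * ((k : ℝ) + 1) ^ (-(s * q.toReal)) := by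
    refine Summable.mul_left _ ?_
    have := (summable_nat_add_iff 1).2 (Real.summable_nat_rpow.2 (show -(s * q.toReal) < -1 by
      linarith))
    simpa using this
  rw [mixedNorm, if_neg hq']
  refine ENNReal.rpow_lt_top_of_nonneg (by positivity) (ENNReal.mul_ne_top ENNReal.ofReal_ne_top ?_)
  refine ne_top_of_le_ne_top hsum.tsum_ofReal_ne_top ?_
  calc _ ≤ ∫⁻ r in ⋃ k, J k, ENNReal.ofReal ((1 - r) ^ (α * q.toReal - 1)) *
        integralMean ∞ r (lacunarySeries N α s) ^ q.toReal := by
        refine lintegral_mono_set fun r hr ↦ ?_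
        obtain ⟨k, hk, hk'⟩ := exists_le_lacunaryRadius hN ⟨hr.1.le, hr.2⟩
        exact Set.mem_iUnion.2 ⟨k, ⟨by linarith, hr.2⟩, hr.1.le, hk⟩
    _ ≤ _ := lintegral_iUnion_le _ _
    _ ≤ _ := ENNReal.tsum_le_tsum hJ

open MeasureTheory in
theorem mixedNorm_lacunarySeries_eq_top {N : ℕ} {α : ℝ} {v : ℝ≥0∞} (hα : 0 < α) (hv : 0 < v)
    (hv' : v ≠ ∞) (hN : 2 ≤ N) (hN1 : 16 * 2 ^ (1 / v.toReal) ≤ (N : ℝ) ^ α)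
    (hN2 : 16 * (N : ℝ) ^ α ≤ Real.exp (N / 2)) {u : ℝ≥0∞} (hu : 0 < u) :
    mixedNorm u v α (lacunarySeries N α (1 / v.toReal)) = ∞ := by
  have h0 : (0 : ℝ) < N := by positivity
  have hN' : (1 : ℝ) < N := by exact_mod_cast (by omega : 1 < N)
  have hv0 : 0 < v.toReal := ENNReal.toReal_pos hv.ne' hv'
  have hs : 0 ≤ 1 / v.toReal := by positivity
  have hc : 0 < α * v.toReal := mul_pos hα hv0
  let D : ℝ := ((1 / 2) ^ (α * v.toReal) - (1 / (2 * N)) ^ (α * v.toReal)) / (α * v.toReal) *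
    (1 / 4) ^ v.toReal
  have hD : 0 < D := by
    have : (1 / (2 * N) : ℝ) ^ (α * v.toReal) < (1 / 2) ^ (α * v.toReal) := by
      refine Real.rpow_lt_rpow (by positivity) ?_ hc
      refine one_div_lt_one_div_of_lt (by norm_num) (by linarith)
    have := sub_pos.2 this
    positivity
  let K : ℕ → Set ℝ := fun k ↦ Set.Ioo (lacunaryRadius N k) (lacunaryRadius N (k + 1))
  have hK : ∀ k, ENNReal.ofReal (D * ((k + 1 : ℕ) : ℝ)⁻¹) ≤
      ∫⁻ r in K k, ENNReal.ofReal ((1 - r) ^ (α * v.toReal - 1)) *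
        integralMean u r (lacunarySeries N α (1 / v.toReal)) ^ v.toReal := by
    intro k
    have hNk : 0 < (N : ℝ) ^ k := by positivity
    have hcoef := lacunaryCoeff_pos hN α (1 / v.toReal) k
    calc _ = (∫⁻ r in K k, ENNReal.ofReal ((1 - r) ^ (α * v.toReal - 1))) *
          ENNReal.ofReal (lacunaryCoeff N α (1 / v.toReal) k / 4) ^ v.toReal := by
          have e1 : 1 - lacunaryRadius N k = 1 / 2 * ((N : ℝ) ^ k)⁻¹ := by
            unfold lacunaryRadius; ring
          have e2 : 1 - lacunaryRadius N (k + 1) = 1 / (2 * N) * ((N : ℝ) ^ k)⁻¹ := by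
            unfold lacunaryRadius; rw [pow_succ]; field_simp; ring
          rw [lintegral_one_sub_rpow hc (lacunaryRadius_mono hN k.le_succ)
            (lacunaryRadius_mem hN _).2.le, e1, e2,
            ENNReal.ofReal_rpow_of_nonneg (by positivity) hv0.le,
            ← ENNReal.ofReal_mul' (by positivity), div_eq_mul_one_div _ (4 : ℝ),
            Real.mul_rpow hcoef.le (by norm_num), lacunaryCoeff_rpow hN,
            Real.mul_rpow (by positivity) (by positivity),
            Real.mul_rpow (by positivity) (by positivity), Real.inv_rpow hNk.le,
            one_div_mul_cancel hv0.ne', Real.rpow_neg_one]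
          congr 1
          have : 0 < ((N : ℝ) ^ k) ^ (α * v.toReal) := by positivity
          simp only [D]
          push_cast
          field_simp
      _ ≤ ∫⁻ r in K k, ENNReal.ofReal ((1 - r) ^ (α * v.toReal - 1)) *
          ENNReal.ofReal (lacunaryCoeff N α (1 / v.toReal) k / 4) ^ v.toReal :=
          lintegral_mul_const_le _ _
      _ ≤ _ := by
          refine setLIntegral_mono' measurableSet_Ioo fun r hr ↦ ?_
          gcongr
          exact lacunaryCoeff_le_integralMean hs hN hN1 hN2 hu hr.1.le
            (hr.2.trans (lacunaryRadius_mem hN _).2)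
  have hdiv : ∑' k : ℕ, ENNReal.ofReal (D * ((k + 1 : ℕ) : ℝ)⁻¹) = ∞ := by
    by_contra h
    have hsum := ENNReal.summable_toReal h
    refine Real.not_summable_natCast_inv ((summable_nat_add_iff 1).1 ?_)
    refine (summable_mul_left_iff hD.ne').1 (hsum.congr fun k ↦ ?_)
    exact ENNReal.toReal_ofReal (by positivity)
  have hint : ∫⁻ r in Set.Ioo (0 : ℝ) 1, ENNReal.ofReal ((1 - r) ^ (α * v.toReal - 1)) *
      integralMean u r (lacunarySeries N α (1 / v.toReal)) ^ v.toReal = ∞ := by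
    refine top_le_iff.1 (hdiv.ge.trans ((ENNReal.tsum_le_tsum hK).trans ?_))
    rw [← lintegral_iUnion (s := K) (fun _ ↦ measurableSet_Ioo)
      (lacunaryRadius_mono hN).pairwise_disjoint_on_Ioo_succ]
    refine lintegral_mono_set (Set.iUnion_subset fun k r hr ↦ ⟨?_, ?_⟩)
    · linarith [hr.1, (lacunaryRadius_mem hN k).1]
    · exact hr.2.trans (lacunaryRadius_mem hN _).2
  rw [mixedNorm, if_neg hv', hint, ENNReal.mul_top (by simpa using hc),
    ENNReal.top_rpow_of_pos (by positivity)]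

/-- `H(∞, q, α) ⊄ H(u, v, α)` as soon as `v < q`, with a witness independent of `q` and `u`. -/
theorem exists_analytic_mixedNorm_eq_top {α : ℝ} (hα : 0 < α) {v : ℝ≥0∞} (hv : 0 < v)
    (hv' : v ≠ ∞) : ∃ f : ℂ → ℂ, AnalyticOnNhd ℂ f (Metric.ball 0 1) ∧
      (∀ q, v < q → mixedNorm ∞ q α f < ∞) ∧ ∀ u, 0 < u → mixedNorm u v α f = ∞ := by
  have hv0 : 0 < v.toReal := ENNReal.toReal_pos hv.ne' hv'
  have hs : 0 ≤ 1 / v.toReal := by positivity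
  obtain ⟨N, hN, hN1, hN2⟩ := exists_lacunary_ratio hα (1 / v.toReal)
  refine ⟨lacunarySeries N α (1 / v.toReal), analyticOnNhd_lacunarySeries hs hN hN1 hN2,
    fun q hq ↦ ?_, fun u hu ↦ mixedNorm_lacunarySeries_eq_top hα hv hv' hN hN1 hN2 hu⟩
  rcases eq_or_ne q ∞ with rfl | hq'
  · exact mixedNorm_top_lacunarySeries_lt_top hα hs hN hN1 hN2
  · refine mixedNorm_lacunarySeries_lt_top hα hs hN hN1 hN2 hq' ?_
    rw [one_div, ← div_eq_inv_mul, one_lt_div hv0]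
    exact ENNReal.toReal_strict_mono hq' hq

/-! ### Inclusions -/

theorem mixedNormSpace_subset {p q u v : ℝ≥0∞} {α β : ℝ} (hα : 0 < α) (hp : 0 < p) (hq : 0 < q)
    (hu : 0 < u) (hv : 0 < v) (hpu : u ≤ p) (h : α < β ∨ (α = β ∧ q ≤ v)) :
    mixedNormSpace p q α ⊆ mixedNormSpace u v β := by
  rintro f ⟨hf, hfin⟩
  refine ⟨hf, (mixedNorm_mono_exponent hu hpu hf).trans_lt ?_⟩
  rcases eq_or_ne v ∞ with rfl | hv'
  · refine (mixedNorm_top_le hp hq hα ?_ hf).trans_lt hfin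
    exact h.elim le_of_lt fun h ↦ h.1.le
  rcases h with h | ⟨rfl, h⟩
  · exact (mixedNorm_le_of_lt hp hq hv hv' hα h hf).trans_lt
      (ENNReal.mul_lt_top ENNReal.ofReal_lt_top hfin)
  · exact (mixedNorm_le_of_le hp hq h hv' hα hf hfin.ne).trans_lt
      (ENNReal.mul_lt_top ENNReal.ofReal_lt_top hfin)

theorem not_mixedNormSpace_subset_of_lt {p q u v : ℝ≥0∞} {α : ℝ} (hα : 0 < α) (hp : 0 < p)
    (hu : 0 < u) (hv : 0 < v) (hvq : v < q) :
    ¬ mixedNormSpace p q α ⊆ mixedNormSpace u v α := by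
  intro hsub
  obtain ⟨f, hf, hfin, htop⟩ := exists_analytic_mixedNorm_eq_top hα hv hvq.ne_top
  have := hsub ⟨hf, (mixedNorm_mono_exponent hp le_top hf).trans_lt (hfin q hvq)⟩
  exact this.2.ne (htop u hu)

theorem theorem1 (p q u v : ℝ≥0∞) (α β : ℝ) (hα : 0 < α) (hβ : 0 < β)
    (hp : 0 < p) (hq : 0 < q) (hu : 0 < u) (hv : 0 < v) (hpu : u ≤ p) :
    (mixedNormSpace p q α ⊆ mixedNormSpace u v β ↔ α < β ∨ (α = β ∧ q ≤ v)) ∧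
    (α < β → v ≠ ∞ → ∀ f ∈ mixedNormSpace p q α,
      mixedNorm u v β f ≤
        ENNReal.ofReal ((β / (β - α)) ^ (1 / v.toReal)) * mixedNorm p q α f) ∧
    (α = β → q ≤ v → v ≠ ∞ → ∀ f ∈ mixedNormSpace p q α,
      mixedNorm u v β f ≤
        ENNReal.ofReal ((v.toReal / q.toReal) ^ (1 / v.toReal)) * mixedNorm p q α f) ∧
    (α < β ∨ (α = β ∧ q ≤ v) → v = ∞ → ∀ f ∈ mixedNormSpace p q α,
      mixedNorm u v β f ≤ mixedNorm p q α f) := by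
  refine ⟨⟨fun hsub ↦ ?_, mixedNormSpace_subset hα hp hq hu hv hpu⟩, ?_, ?_, ?_⟩
  · rcases lt_trichotomy α β with h | rfl | h
    · exact Or.inl h
    · refine Or.inr ⟨rfl, le_of_not_gt fun hvq ↦ ?_⟩
      exact not_mixedNormSpace_subset_of_lt hα hp hu hv hvq hsub
    · exfalso
      -- The chain `H(p, ∞, γ) ⊆ H(p, q, α) ⊆ H(u, v, β) ⊆ H(u, 1, γ)` has equal weights at
      -- its ends.
      obtain ⟨γ, hβγ, hγα⟩ := exists_between h
      have hγ : 0 < γ := hβ.trans hβγ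
      exact not_mixedNormSpace_subset_of_lt (q := ∞) hγ hp hu one_pos ENNReal.one_lt_top
        (((mixedNormSpace_subset hγ hp ENNReal.zero_lt_top hp hq le_rfl (Or.inl hγα)).trans
          hsub).trans (mixedNormSpace_subset hβ hu hv hu one_pos le_rfl (Or.inl hβγ)))
  · intro h hv' f hf
    exact (mixedNorm_mono_exponent hu hpu hf.1).trans
      (mixedNorm_le_of_lt hp hq hv hv' hα h hf.1)
  · rintro rfl hqv hv' f hf
    exact (mixedNorm_mono_exponent hu hpu hf.1).trans
      (mixedNorm_le_of_le hp hq hqv hv' hα hf.1 hf.2.ne)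
  · rintro h rfl f hf
    exact (mixedNorm_mono_exponent hu hpu hf.1).trans
      (mixedNorm_top_le hp hq hα (h.elim le_of_lt fun h ↦ h.1.le) hf.1)
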